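/- Theorem. Let $n\ge 1$, let $\mathcal M_n$ be the space of $n\times n$ complex matrices, and let $|||\cdot|||$ be any unitarily invariant norm on $\mathcal M_n$, that is, a norm with $|||UAV|||=|||A|||$ for all $A\in\mathcal M_n$ and all unitary $U,V\in\mathcal M_n$. Let $A,B\in\mathcal M_n$ be (Hermitian) positive definite, let $X\in\mathcal M_n$ with $X\neq 0$, and let $r\ge 0$ be real. Then $$(1+r)\,|||AX|||-r\,|||XB|||+r\left(\sqrt{|||AX|||}-\sqrt{|||XB|||}\right)^2\le |||A^{1+r}XB^{-r}|||,$$ where the real powers of $A$ and $B$ are defined by the functional calculus. -/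

import Mathlib

open scoped MatrixOrder ComplexOrder

/-- A norm `N` on the space of complex `n × n` matrices is unitarily invariant: `N` is a seminorm
over `ℂ` that vanishes only at `0`, and `N (U A V) = N A` for all unitary `U`, `V`. -/
structure IsUnitarilyInvariantNorm {n : ℕ} (N : Seminorm ℂ (Matrix (Fin n) (Fin n) ℂ)) :
    Prop where
  eq_zero_of_map_eq_zero : ∀ A : Matrix (Fin n) (Fin n) ℂ, N A = 0 → A = 0
  map_unitary_mul_mul_unitary : ∀ U ∈ Matrix.unitaryGroup (Fin n) ℂ,
    ∀ V ∈ Matrix.unitaryGroup (Fin n) ℂ, ∀ A : Matrix (Fin n) (Fin n) ℂ, N (U * A * V) = N A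

/-! With p = 1 + r, consider the entire function F(z) = A^{pz} X B^{1-pz}. Imaginary powers are
unitary, so the norm of F equals |||XB||| on Re z = 0 and |||A^{1+r} X B^{-r}||| on Re z = 1, while
F(1/p) = AX. The three lines theorem gives a^{1+r} ≤ b^r c for a = |||AX|||, b = |||XB|||, c =
|||A^{1+r} X B^{-r}||| (`map_mul_le_rpow_mul_rpow`). The rest is scalar: weighted AM-GM for c and
√(ab) (`refined_young_of_le_rpow_mul_rpow`). -/

/-- The three lines theorem for a finite sum of vector-valued exponentials. -/
lemma norm_sum_exp_smul_le {E ι : Type*} [NormedAddCommGroup E] [NormedSpace ℂ E] [Fintype ι]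
    (c : ι → ℝ) (v : ι → E) {a b θ : ℝ} (hθ₀ : 0 ≤ θ) (hθ₁ : θ ≤ 1)
    (ha : ∀ z : ℂ, z.re = 0 → ‖∑ k, Complex.exp (z * c k) • v k‖ ≤ a)
    (hb : ∀ z : ℂ, z.re = 1 → ‖∑ k, Complex.exp (z * c k) • v k‖ ≤ b) :
    ‖∑ k, Complex.exp (θ * c k) • v k‖ ≤ a ^ (1 - θ) * b ^ θ := by
  have hd : Differentiable ℂ fun z : ℂ => ∑ k, Complex.exp (z * c k) • v k := by fun_prop
  refine Complex.HadamardThreeLines.norm_le_interp_of_mem_verticalClosedStrip₀₁'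
    (fun z : ℂ => ∑ k, Complex.exp (z * c k) • v k) (z := (θ : ℂ)) ⟨by simpa, by simpa⟩
    hd.diffContOnCl ?_ ha hb
  refine ⟨∑ k, Real.exp |c k| * ‖v k‖, ?_⟩
  rintro _ ⟨z, hz, rfl⟩
  refine norm_sum_le_of_le _ fun k _ => ?_
  rw [norm_smul, Complex.norm_exp]
  obtain ⟨h₀, h₁⟩ : 0 ≤ z.re ∧ z.re ≤ 1 := hz
  have hle : (z * c k).re ≤ |c k| := by
    rw [Complex.re_mul_ofReal]
    calc z.re * c k ≤ z.re * |c k| := by gcongr; exact le_abs_self _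
      _ ≤ 1 * |c k| := by gcongr
      _ = |c k| := one_mul _
  gcongr

/-- The three lines theorem for a finite sum of exponentials, for a seminorm that is a norm. -/
lemma Seminorm.map_sum_exp_smul_le {E ι : Type*} [AddCommGroup E] [Module ℂ E] [Fintype ι]
    (N : Seminorm ℂ E) (hN : ∀ x, N x = 0 → x = 0) (c : ι → ℝ) (v : ι → E) {a b θ : ℝ}
    (hθ₀ : 0 ≤ θ) (hθ₁ : θ ≤ 1)
    (ha : ∀ z : ℂ, z.re = 0 → N (∑ k, Complex.exp (z * c k) • v k) ≤ a)
    (hb : ∀ z : ℂ, z.re = 1 → N (∑ k, Complex.exp (z * c k) • v k) ≤ b) :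
    N (∑ k, Complex.exp (θ * c k) • v k) ≤ a ^ (1 - θ) * b ^ θ := by
  let : Norm E := ⟨N⟩
  have core : NormedSpace.Core ℂ E :=
    { norm_nonneg := fun x => apply_nonneg N x
      norm_smul := fun c x => map_smul_eq_mul N c x
      norm_triangle := fun x y => map_add_le_add N x y
      norm_eq_zero_iff := fun x => ⟨hN x, fun h => h ▸ map_zero N⟩ }
  let : NormedAddCommGroup E := NormedAddCommGroup.ofCore core
  let : NormedSpace ℂ E := NormedSpace.ofCore core
  exact norm_sum_exp_smul_le c v hθ₀ hθ₁ ha hb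

namespace IsUnitarilyInvariantNorm

open Matrix

variable {n : ℕ} {N : Seminorm ℂ (Matrix (Fin n) (Fin n) ℂ)}

lemma diagonal_exp_mem_unitaryGroup (d : Fin n → ℂ) (hd : ∀ i, (d i).re = 0) :
    diagonal (fun i => Complex.exp (d i)) ∈ unitaryGroup (Fin n) ℂ := by
  rw [mem_unitaryGroup_iff, star_eq_conjTranspose, diagonal_conjTranspose, diagonal_mul_diagonal,
    ← diagonal_one]
  congr 1
  ext i
  simp only [Pi.star_apply, Complex.star_def, Complex.mul_conj, Complex.normSq_eq_norm_sq,
    Complex.norm_exp, hd]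
  simp

/-- The imaginary parts of the exponents contribute only diagonal unitary factors. This makes the
norm constant on each vertical line. -/
lemma map_diagonal_exp_mul_mul_diagonal_exp_congr (hN : IsUnitarilyInvariantNorm N)
    (Y : Matrix (Fin n) (Fin n) ℂ) {a a' b b' : Fin n → ℂ} (ha : ∀ i, (a i).re = (a' i).re)
    (hb : ∀ i, (b i).re = (b' i).re) :
    N (diagonal (fun i => Complex.exp (a i)) * Y * diagonal (fun i => Complex.exp (b i))) =
      N (diagonal (fun i => Complex.exp (a' i)) * Y * diagonal (fun i => Complex.exp (b' i))) := by
  rw [← hN.map_unitary_mul_mul_unitary _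
    (diagonal_exp_mem_unitaryGroup (fun i => a i - a' i) (by simp [ha])) _
    (diagonal_exp_mem_unitaryGroup (fun i => b i - b' i) (by simp [hb]))
    (diagonal (fun i => Complex.exp (a' i)) * Y * diagonal (fun i => Complex.exp (b' i)))]
  congr 1
  ext i j
  simp only [diagonal_mul, mul_diagonal]
  rw [Complex.exp_sub, Complex.exp_sub]
  field_simp

lemma map_diagonal_exp_mul_le (hN : IsUnitarilyInvariantNorm N)
    (Y : Matrix (Fin n) (Fin n) ℂ) (a b : Fin n → ℝ) {p : ℝ} (hp : 1 ≤ p) :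
    N (diagonal (fun i => Complex.exp (a i)) * Y) ≤
      N (Y * diagonal (fun i => Complex.exp (b i))) ^ (1 - p⁻¹) *
      N (diagonal (fun i => Complex.exp (p * a i)) * Y *
        diagonal (fun i => Complex.exp ((1 - p) * b i))) ^ p⁻¹ := by
  -- In eigenbases F is entrywise an exponential with real frequency p(a_i - b_j), hence a finite
  -- sum over matrix units.
  have key (z : ℂ) : ∑ k : Fin n × Fin n, Complex.exp (z * (p * (a k.1 - b k.2) : ℝ)) •
      single k.1 k.2 (Y k.1 k.2 * Complex.exp (b k.2)) =
      diagonal (fun i => Complex.exp (p * z * a i)) * Y *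
        diagonal (fun i => Complex.exp ((1 - p * z) * b i)) := by
    ext i j
    rw [Fintype.sum_prod_type, Matrix.sum_apply, Finset.sum_eq_single i, Matrix.sum_apply,
      Finset.sum_eq_single j]
    · simp only [smul_single, single_apply_same, diagonal_mul, mul_diagonal, smul_eq_mul]
      rw [mul_left_comm, ← Complex.exp_add, mul_right_comm, ← Complex.exp_add, mul_comm]
      congr 2
      push_cast
      ring
    · intro j' _ h
      simp [h]
    · simp
    · intro i' _ h
      rw [Matrix.sum_apply]
      exact Finset.sum_eq_zero fun j' _ => by simp [h]
    · simp
  have hp₀ : (p : ℂ) ≠ 0 := by exact_mod_cast (by linarith : p ≠ 0)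
  have h := N.map_sum_exp_smul_le hN.eq_zero_of_map_eq_zero
    (fun k : Fin n × Fin n => p * (a k.1 - b k.2))
    (fun k => single k.1 k.2 (Y k.1 k.2 * Complex.exp (b k.2)))
    (a := N (Y * diagonal (fun i => Complex.exp (b i))))
    (b := N (diagonal (fun i => Complex.exp (p * a i)) * Y *
        diagonal (fun i => Complex.exp ((1 - p) * b i))))
    (θ := p⁻¹) (by positivity) (inv_le_one_of_one_le₀ hp) ?_ ?_
  · rw [key] at h
    simpa [hp₀] using h
  · intro z hz
    rw [key, hN.map_diagonal_exp_mul_mul_diagonal_exp_congr Y (a' := fun _ => 0)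
      (b' := fun i => b i) (by simp [hz]) (by simp [hz])]
    simp
  · intro z hz
    rw [key, hN.map_diagonal_exp_mul_mul_diagonal_exp_congr Y (a' := fun i => p * a i)
      (b' := fun i => (1 - p) * b i) (by simp [hz]) (by simp [hz])]

end IsUnitarilyInvariantNorm

/-- A positive definite matrix is unitarily diagonalizable with positive eigenvalues, and its real
powers are computed in the diagonalization. -/
lemma Matrix.PosDef.exists_rpow_eq {n : ℕ} {A : Matrix (Fin n) (Fin n) ℂ} (hA : A.PosDef) :
    ∃ U ∈ Matrix.unitaryGroup (Fin n) ℂ, ∃ a : Fin n → ℝ, ∀ s : ℝ,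
      CFC.rpow A s = U * Matrix.diagonal (fun i => Complex.exp (s * a i)) * star U := by
  refine ⟨hA.isHermitian.eigenvectorUnitary, hA.isHermitian.eigenvectorUnitary.2,
    fun i => Real.log (hA.isHermitian.eigenvalues i), fun s => ?_⟩
  have h : CFC.rpow A s = cfc (fun x : ℝ => x ^ s) A := CFC.rpow_eq_cfc_real hA.posSemidef.nonneg
  rw [h, hA.isHermitian.cfc_eq, Matrix.IsHermitian.cfc, Unitary.conjStarAlgAut_apply]
  congr 3
  ext i
  simp only [Function.comp_apply]
  rw [Real.rpow_def_of_pos (hA.eigenvalues_pos i), mul_comm]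
  simp

/-- The Heinz inequality for unitarily invariant norms, in its reversed form. -/
lemma IsUnitarilyInvariantNorm.map_mul_le_rpow_mul_rpow {n : ℕ}
    {N : Seminorm ℂ (Matrix (Fin n) (Fin n) ℂ)} (hN : IsUnitarilyInvariantNorm N)
    {A B : Matrix (Fin n) (Fin n) ℂ} (hA : A.PosDef) (hB : B.PosDef)
    (X : Matrix (Fin n) (Fin n) ℂ) {r : ℝ} (hr : 0 ≤ r) :
    N (A * X) ≤ N (X * B) ^ (1 - (1 + r)⁻¹) *
      N (CFC.rpow A (1 + r) * X * CFC.rpow B (-r)) ^ (1 + r)⁻¹ := by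
  obtain ⟨U, hU, a, ha⟩ := hA.exists_rpow_eq
  obtain ⟨V, hV, b, hb⟩ := hB.exists_rpow_eq
  have hA₁ : CFC.rpow A 1 = A := CFC.rpow_one A hA.posSemidef.nonneg
  have hB₁ : CFC.rpow B 1 = B := CFC.rpow_one B hB.posSemidef.nonneg
  have hA' := ha 1
  have hB' := hb 1
  rw [hA₁] at hA'
  rw [hB₁] at hB'
  have hU₁ : U * star U = 1 := Matrix.mem_unitaryGroup_iff.1 hU
  have hV₁ : V * star V = 1 := Matrix.mem_unitaryGroup_iff.1 hV
  have hV' : star V ∈ Matrix.unitaryGroup (Fin n) ℂ := Unitary.star_mem hV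
  have h := hN.map_diagonal_exp_mul_le (star U * X * V) a b (p := 1 + r) (by linarith)
  have e₁ : A * X =
      U * (Matrix.diagonal (fun i => Complex.exp (a i)) * (star U * X * V)) * star V := by
    rw [hA']
    simp [Matrix.mul_assoc, hV₁]
  have e₂ : X * B =
      U * (star U * X * V * Matrix.diagonal (fun i => Complex.exp (b i))) * star V := by
    rw [hB']
    simp only [← Matrix.mul_assoc, hU₁]
    simp
  have e₃ : CFC.rpow A (1 + r) * X * CFC.rpow B (-r) =
      U * (Matrix.diagonal (fun i => Complex.exp ((1 + r : ℝ) * a i)) * (star U * X * V) *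
        Matrix.diagonal (fun i => Complex.exp ((1 - (1 + r : ℝ)) * b i))) * star V := by
    rw [ha, hb]
    simp [Matrix.mul_assoc]
  have hUV := hN.map_unitary_mul_mul_unitary U hU (star V) hV'
  rwa [e₁, e₂, e₃, hUV, hUV, hUV]

/-- If `a` is at most a weighted geometric mean of `b` and `c`, then a refined Young inequality
holds. -/
lemma refined_young_of_le_rpow_mul_rpow {a b c r : ℝ} (ha : 0 ≤ a) (hb : 0 ≤ b) (hc : 0 ≤ c)
    (hr : 0 ≤ r) (h : a ≤ b ^ (1 - (1 + r)⁻¹) * c ^ (1 + r)⁻¹) :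
    (1 + r) * a - r * b + r * (√a - √b) ^ 2 ≤ c := by
  have hs : (√a - √b) ^ 2 = a + b - 2 * √(a * b) := by
    rw [sub_sq, Real.sq_sqrt ha, Real.sq_sqrt hb, Real.sqrt_mul ha]
    ring
  -- Expanding the square cancels the two terms r * b; this is what remains.
  have key : (1 + 2 * r) * a ≤ c + 2 * r * √(a * b) := by
    -- The hypothesis raised to the power (1 + r) / (1 + 2r); multiplying by a^{r/(1+2r)} then pairs
    -- a with b inside √(ab).
    have hle : a ^ ((1 + r) / (1 + 2 * r)) ≤ b ^ (r / (1 + 2 * r)) * c ^ (1 / (1 + 2 * r)) := by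
      refine (Real.rpow_le_rpow ha h (by positivity)).trans_eq ?_
      rw [Real.mul_rpow (by positivity) (by positivity), ← Real.rpow_mul hb, ← Real.rpow_mul hc]
      congr 2 <;> field_simp
      ring
    have ham := Real.geom_mean_le_arith_mean2_weighted (w₁ := 1 / (1 + 2 * r))
      (w₂ := 2 * r / (1 + 2 * r)) (by positivity) (by positivity) hc (Real.sqrt_nonneg (a * b))
      (by field_simp)
    have hgm : a ≤ c ^ (1 / (1 + 2 * r)) * √(a * b) ^ (2 * r / (1 + 2 * r)) := by
      calc a = a ^ (r / (1 + 2 * r)) * a ^ ((1 + r) / (1 + 2 * r)) := by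
            rw [← Real.rpow_add_of_nonneg ha (by positivity) (by positivity), ← add_div,
              show r + (1 + r) = 1 + 2 * r by ring, div_self (by positivity), Real.rpow_one]
        _ ≤ a ^ (r / (1 + 2 * r)) * (b ^ (r / (1 + 2 * r)) * c ^ (1 / (1 + 2 * r))) := by gcongr
        _ = _ := by
            rw [Real.sqrt_eq_rpow, ← Real.rpow_mul (by positivity), ← mul_assoc,
              ← Real.mul_rpow ha hb, mul_comm]
            congr 2
            ring
    have h1 := hgm.trans ham
    calc (1 + 2 * r) * a
        ≤ (1 + 2 * r) * (1 / (1 + 2 * r) * c + 2 * r / (1 + 2 * r) * √(a * b)) := by gcongr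
      _ = c + 2 * r * √(a * b) := by field_simp
  rw [hs]
  linarith

theorem mainTheorem3 {n : ℕ} (A B X : Matrix (Fin n) (Fin n) ℂ) (hA : A.PosDef) (hB : B.PosDef)
    (hX : X ≠ 0) (r : ℝ) (hr : 0 ≤ r) (N : Seminorm ℂ (Matrix (Fin n) (Fin n) ℂ))
    (hN : IsUnitarilyInvariantNorm N) :
    (1 + r) * N (A * X) - r * N (X * B) + r * (√(N (A * X)) - √(N (X * B))) ^ 2 ≤
      N (CFC.rpow A (1 + r) * X * CFC.rpow B (-r)) :=
  refined_young_of_le_rpow_mul_rpow (apply_nonneg N _) (apply_nonneg N _) (apply_nonneg N _) hr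
    (hN.map_mul_le_rpow_mul_rpow hA hB X hr)
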